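/- Let $\lambda$ be a regular cardinal with $\aleph_1<\lambda<2^{\aleph_0}$. For a class $K$ of structures and a notion of embedding, a universal member of $K$ in $\lambda$ is an $M\in K$ of cardinality $\lambda$ such that every $N\in K$ of cardinality at most $\lambda$ embeds into $M$. An ordinary embedding is an isomorphism onto a substructure. 1. With respect to ordinary embeddings, none of the following classes has a universal member in $\lambda$: partial orders; Boolean algebras with $0\neq 1$ (embeddings preserve $\wedge,\vee,0,1$ and complements); lattices (embeddings preserve $\wedge,\vee$); linearly ordered fields; linearly ordered groups (not necessarily commutative, the order being invariant under left and right translations), and likewise linearly ordered commutative groups. 2. With respect to elementary embeddings, none of the following first-order theories has a universal model in $\lambda$: complete number theory $\mathrm{Th}(\mathbb N,0,S,+,\cdot)$ and, more generally, every theory in the language $(0,S,+,\cdot)$ that contains the axioms of Peano arithmetic; and, for every prime $p$, the complete theory, in the language of rings $(+,\cdot,-,0,1)$, of the ring $\mathbb Z_p$ of $p$-adic integers and of the integral closure of $\mathbb Z_p$ in any finite extension of $\mathbb Q_p$. -/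

import Mathlib

universe u

namespace UniversalModels


section Ordinary

/-!
Universal models with respect to ordinary embeddings, that is, injective maps that are
isomorphisms onto a substructure.  A universal model in `κ` is a member of the class of
cardinality `κ` into which every member of the class of cardinality at most `κ` embeds.
-/

/-- There is a universal partial order in cardinality `κ`. -/
def HasUniversalPartialOrder (κ : Cardinal.{u}) : Prop :=
  ∃ (P : Type u) (_ : PartialOrder P), Cardinal.mk P = κ ∧
    ∀ (Q : Type u) [PartialOrder Q], Cardinal.mk Q ≤ κ → Nonempty (Q ↪o P)

/-- There is a universal Boolean algebra in cardinality `κ`.  Boolean algebras satisfy `0 ≠ 1`,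
and embeddings are the injective maps that preserve `∧`, `∨`, `0`, `1` (hence complements). -/
def HasUniversalBooleanAlgebra (κ : Cardinal.{u}) : Prop :=
  ∃ (A : Type u) (_ : BooleanAlgebra A) (_ : Nontrivial A), Cardinal.mk A = κ ∧
    ∀ (B : Type u) [BooleanAlgebra B] [Nontrivial B], Cardinal.mk B ≤ κ →
      ∃ f : BoundedLatticeHom B A, Function.Injective f

/-- There is a universal lattice in cardinality `κ`; embeddings are the injective maps that
preserve `∧` and `∨`. -/
def HasUniversalLattice (κ : Cardinal.{u}) : Prop :=
  ∃ (A : Type u) (_ : Lattice A), Cardinal.mk A = κ ∧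
    ∀ (B : Type u) [Lattice B], Cardinal.mk B ≤ κ →
      ∃ f : LatticeHom B A, Function.Injective f

/-- There is a universal (linearly) ordered field in cardinality `κ`; embeddings are the order
preserving field embeddings. -/
def HasUniversalOrderedField (κ : Cardinal.{u}) : Prop :=
  ∃ (F : Type u) (_ : Field F) (_ : LinearOrder F) (_ : IsStrictOrderedRing F),
    Cardinal.mk F = κ ∧
    ∀ (E : Type u) [Field E] [LinearOrder E] [IsStrictOrderedRing E], Cardinal.mk E ≤ κ →
      ∃ f : E →+* F, StrictMono f

/-- There is a universal (linearly, bi-invariantly) ordered group, not necessarily commutative, in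
cardinality `κ`; embeddings are the order preserving injective group homomorphisms. -/
def HasUniversalOrderedGroup (κ : Cardinal.{u}) : Prop :=
  ∃ (G : Type u) (_ : Group G) (_ : LinearOrder G) (_ : MulLeftMono G) (_ : MulRightMono G),
    Cardinal.mk G = κ ∧
    ∀ (H : Type u) [Group H] [LinearOrder H] [MulLeftMono H] [MulRightMono H],
      Cardinal.mk H ≤ κ → ∃ f : H →* G, StrictMono f

/-- There is a universal (linearly) ordered commutative group in cardinality `κ`. -/
def HasUniversalOrderedCommGroup (κ : Cardinal.{u}) : Prop :=
  ∃ (G : Type u) (_ : CommGroup G) (_ : LinearOrder G) (_ : IsOrderedMonoid G),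
    Cardinal.mk G = κ ∧
    ∀ (H : Type u) [CommGroup H] [LinearOrder H] [IsOrderedMonoid H],
      Cardinal.mk H ≤ κ → ∃ f : H →* G, StrictMono f

end Ordinary

section Elementary

/-- The first-order theory `T` has a universal model in cardinality `κ` with respect to elementary
embeddings. -/
def HasElementaryUniversalModel {L : FirstOrder.Language.{0, 0}} (T : L.Theory) (κ : Cardinal.{u}) : Prop :=
  ∃ M : FirstOrder.Language.Theory.ModelType.{0, 0, u} T, Cardinal.mk M = κ ∧
    ∀ N : FirstOrder.Language.Theory.ModelType.{0, 0, u} T, Cardinal.mk N ≤ κ → Nonempty (L.ElementaryEmbedding N M)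

/-- Function symbols of arithmetic: zero, successor, addition, multiplication. -/
inductive ArithFunc : ℕ → Type
  | zero : ArithFunc 0
  | succ : ArithFunc 1
  | add : ArithFunc 2
  | mul : ArithFunc 2

/-- The first-order language of arithmetic. -/
def arith : FirstOrder.Language.{0, 0} := ⟨ArithFunc, fun _ => Empty⟩

/-- The term `0`. -/
def tZero {α : Type} : arith.Term α := FirstOrder.Language.Term.func (ArithFunc.zero : arith.Functions 0) ![]

/-- The term `S t`. -/
def tSucc {α : Type} (t : arith.Term α) : arith.Term α :=
  FirstOrder.Language.Term.func (ArithFunc.succ : arith.Functions 1) ![t]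

/-- The term `s + t`. -/
def tAdd {α : Type} (s t : arith.Term α) : arith.Term α :=
  FirstOrder.Language.Term.func (ArithFunc.add : arith.Functions 2) ![s, t]

/-- The term `s * t`. -/
def tMul {α : Type} (s t : arith.Term α) : arith.Term α :=
  FirstOrder.Language.Term.func (ArithFunc.mul : arith.Functions 2) ![s, t]

/-- The standard structure of arithmetic on the natural numbers. -/
instance natStructure : arith.Structure ℕ where
  funMap := fun {_} f =>
    match f with
    | ArithFunc.zero => fun _ => 0
    | ArithFunc.succ => fun x => x 0 + 1
    | ArithFunc.add => fun x => x 0 + x 1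
    | ArithFunc.mul => fun x => x 0 * x 1
  RelMap := fun {_} r => nomatch r

/-- The universal closure of a formula with `n` free variables. -/
noncomputable def closure {n : ℕ} (φ : arith.Formula (Fin n)) : arith.Sentence :=
  FirstOrder.Language.Formula.iAlls (Fin n) (φ.relabel (Sum.inr : Fin n → Empty ⊕ Fin n))

/-- The induction axiom for `φ(x, y)`, with parameters `x = (x₀, …, xₙ₋₁)`:
`∀ x, (φ(x, 0) ∧ ∀ y, (φ(x, y) → φ(x, S y))) → ∀ y, φ(x, y)`. -/
noncomputable def inductionAxiom {n : ℕ} (φ : arith.Formula (Fin n ⊕ Unit)) : arith.Sentence :=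
  closure
    (((FirstOrder.Language.BoundedFormula.subst φ (Sum.elim FirstOrder.Language.Term.var fun _ => tZero) :
          arith.Formula (Fin n)) ⊓
        FirstOrder.Language.Formula.iAlls Unit
          (FirstOrder.Language.BoundedFormula.imp φ
            (FirstOrder.Language.BoundedFormula.subst φ
              (Sum.elim (fun i => FirstOrder.Language.Term.var (Sum.inl i))
                fun i => tSucc (FirstOrder.Language.Term.var (Sum.inr i)))))).imp
      (FirstOrder.Language.Formula.iAlls Unit φ))

/-- The variable `i`. -/
def v {n : ℕ} (i : Fin n) : arith.Term (Fin n) := FirstOrder.Language.Term.var i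

/-- First-order Peano arithmetic. -/
def peanoArithmetic : arith.Theory :=
  { closure (n := 1) (FirstOrder.Language.Term.equal (tSucc (v 0)) tZero).not,
    closure (n := 2) ((FirstOrder.Language.Term.equal (tSucc (v 0)) (tSucc (v 1))).imp
      (FirstOrder.Language.Term.equal (v 0) (v 1))),
    closure (n := 1) (FirstOrder.Language.Term.equal (tAdd (v 0) tZero) (v 0)),
    closure (n := 2) (FirstOrder.Language.Term.equal (tAdd (v 0) (tSucc (v 1))) (tSucc (tAdd (v 0) (v 1)))),
    closure (n := 1) (FirstOrder.Language.Term.equal (tMul (v 0) tZero) tZero),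
    closure (n := 2) (FirstOrder.Language.Term.equal (tMul (v 0) (tSucc (v 1)))
      (tAdd (tMul (v 0) (v 1)) (v 0))) } ∪
  { ψ | ∃ (n : ℕ) (φ : arith.Formula (Fin n ⊕ Unit)), ψ = inductionAxiom φ }

/-- Complete number theory: all first-order sentences true in `(ℕ, 0, S, +, ·)`. -/
def completeNumberTheory : arith.Theory := arith.completeTheory ℕ

/-- The natural numbers satisfy the Peano axioms. -/
theorem peanoArithmetic_subset_completeNumberTheory :
    peanoArithmetic ⊆ completeNumberTheory := by
  have hz : ∀ {α : Type} (x : α → ℕ), (tZero : arith.Term α).realize x = 0 := fun _ => rfl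
  have hs : ∀ {α : Type} (x : α → ℕ) (t : arith.Term α),
      (tSucc t).realize x = t.realize x + 1 := fun _ _ => rfl
  have ha : ∀ {α : Type} (x : α → ℕ) (s t : arith.Term α),
      (tAdd s t).realize x = s.realize x + t.realize x := fun _ _ _ => rfl
  have hm : ∀ {α : Type} (x : α → ℕ) (s t : arith.Term α),
      (tMul s t).realize x = s.realize x * t.realize x := fun _ _ _ => rfl
  have hv : ∀ {n : ℕ} (x : Fin n → ℕ) (i : Fin n), (v i).realize x = x i := fun _ _ => rfl
  have hc : ∀ {n : ℕ} (φ : arith.Formula (Fin n)),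
      closure φ ∈ completeNumberTheory ↔ ∀ x : Fin n → ℕ, φ.Realize x := by
    intro n φ
    rw [completeNumberTheory, FirstOrder.Language.mem_completeTheory,
      FirstOrder.Language.Sentence.Realize, closure, FirstOrder.Language.Formula.realize_iAlls]
    refine forall_congr' fun x => ?_
    rw [FirstOrder.Language.Formula.realize_relabel]
    rfl
  rintro ψ ((rfl | rfl | rfl | rfl | rfl | rfl) | ⟨n, φ, rfl⟩)
  · rw [hc]; intro x
    rw [FirstOrder.Language.Formula.realize_not, FirstOrder.Language.Formula.realize_equal, hs, hz]; omega
  · rw [hc]; intro x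
    rw [FirstOrder.Language.Formula.realize_imp, FirstOrder.Language.Formula.realize_equal,
      FirstOrder.Language.Formula.realize_equal, hs, hs]; omega
  · rw [hc]; intro x
    rw [FirstOrder.Language.Formula.realize_equal, ha, hz]; omega
  · rw [hc]; intro x
    rw [FirstOrder.Language.Formula.realize_equal, ha, hs, hs, ha]; omega
  · rw [hc]; intro x
    rw [FirstOrder.Language.Formula.realize_equal, hm, hz]; omega
  · rw [hc]; intro x
    rw [FirstOrder.Language.Formula.realize_equal, hm, hs, ha, hm]; ring
  · rw [inductionAxiom, hc]; intro x
    rw [FirstOrder.Language.Formula.realize_imp, FirstOrder.Language.Formula.realize_inf,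
      FirstOrder.Language.Formula.realize_iAlls, FirstOrder.Language.Formula.realize_iAlls]
    rintro ⟨h0, h1⟩ y
    have key : ∀ k : ℕ, φ.Realize (Sum.elim x fun _ => k) := by
      intro k
      induction k with
      | zero =>
        have h := FirstOrder.Language.BoundedFormula.realize_subst.1 h0
        exact (iff_of_eq (congrArg₂ (fun w z => FirstOrder.Language.BoundedFormula.Realize φ w z)
          (by funext a; cases a <;> rfl) rfl)).1 h
      | succ k ih =>
        have h := FirstOrder.Language.BoundedFormula.realize_subst.1
          (FirstOrder.Language.BoundedFormula.realize_imp.1 (h1 fun _ => k)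
            ih)
        exact (iff_of_eq (congrArg₂ (fun w z => FirstOrder.Language.BoundedFormula.Realize φ w z)
          (by funext a; cases a <;> rfl) rfl)).1 h
    exact key (y ())

/-- The complete first-order theory of a ring `R` in the language `(+, ·, -, 0, 1)`. -/
def completeRingTheory (R : Type) [Ring R] : FirstOrder.Language.ring.Theory :=
  letI := FirstOrder.Ring.compatibleRingOfRing R
  FirstOrder.Language.ring.completeTheory R

end Elementary

end UniversalModels

/-!
The theorem reduces to one combinatorial fact, `exists_linearOrder_forall_not_strictMono`: if `κ` is
regular with `ℵ₁ < κ < 2 ^ ℵ₀` and `R` is a strict partial order on a set `N` of size `κ`, then some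
linear order of size at most `κ` admits no strictly increasing map into `(N, R)`.

The fact is proved by the method of Kojman and Shelah.  Club guessing (`exists_club_guessing`)
provides `κ` many `ω`-sequences of points of `κ` such that every club contains one of them.  For
each `b : ℕ → Bool` one forms a linear order `M b` of size `κ`, a set of sequences of reals under
the lexicographic order: it contains the finite sequences of reals from a fixed set of size `κ`,
ended by a rational, and, for each guessing sequence, one infinite branch that follows the
subsequence coded by `b`.  If `M b` maps into `N`, then along a guessing sequence inside a suitable
club, `b` can be read off from the image of the branch alone (`exists_club_marked_iff`): one asks
at which stages of an enumeration of `N` the cut of that image is realized before the next stage.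
So `b` is determined by a pair in `κ × N`, while there are `2 ^ ℵ₀ > κ` many `b`.

It remains to realize an arbitrary linear order as a chain in a member of each class.  A linear order
is itself a partial order and a lattice, and it generates an interval algebra.  It embeds into an
ordered field inside an ultrapower of `ℚ`, whose additive group serves for the ordered groups.  For
a first-order theory, a formula that defines a strict partial order in the models and has an infinite
chain in one model has chains of every order type in models of the right size, by an ultrapower
and the downward Löwenheim–Skolem theorem (`exists_model_chain`).  The formulas are `x < y` for
arithmetic, and proper divisibility with the chain of powers of `p` for the `p`-adic rings.
-/

universe v

namespace UniversalModels

open Cardinal Order Set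

/-! ### Club guessing -/

section ClubGuessing

attribute [local instance]
  WellFoundedLT.toOrderBot WellFoundedLT.conditionallyCompleteLinearOrderBot

/-- A sequence in which every term is exceeded by some term has a strictly increasing selection of
terms that all exceed the first one. -/
theorem exists_strictMono_subseq_of_forall_exists_lt {α : Type*} [Preorder α] {p : ℕ → α}
    (hp : ∀ n, ∃ m, p n < p m) : ∃ g : ℕ → ℕ, StrictMono (p ∘ g) ∧ ∀ k, p 0 < p (g k) := by
  choose h hh using hp
  let g : ℕ → ℕ := fun k => Nat.rec (h 0) (fun _ n => h n) k
  refine ⟨g, strictMono_nat_of_lt_succ fun n => hh (g n), ?_⟩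
  intro k
  induction k with
  | zero => exact hh 0
  | succ k ih => exact ih.trans (hh (g k))

/-- In a linear order of uncountable cofinality countable sets are bounded. -/
theorem bddAbove_range_of_aleph0_lt_cof {α : Type u} [LinearOrder α] (hα : ℵ₀ < cof α)
    {ι : Type*} [Countable ι] (f : ι → α) :
    BddAbove (range f) := by
  refine .of_not_isCofinal fun h => (cof_le h).not_gt (hα.trans_le' ?_)
  exact mk_le_aleph0_iff.2 (countable_range f)

theorem noMaxOrder_of_aleph0_lt_cof {α : Type u} [LinearOrder α] (hα : ℵ₀ < cof α) :
    NoMaxOrder α := by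
  have : Nonempty α := cof_ne_zero_iff.1 (aleph0_pos.trans hα).ne'
  have := one_lt_cof_iff.1 (one_lt_aleph0.trans hα)
  exact (noTopOrder_iff_noMaxOrder α).1 this

variable {α : Type u} [LinearOrder α] [WellFoundedLT α]

/-- `δ` is a limit point of `E`. -/
def IsLimitPoint (E : Set α) (δ : α) : Prop := ∀ a < δ, ∃ e ∈ E, a < e ∧ e < δ

/-- `d` is a ladder on `δ`: a strictly increasing sequence of length `ω` with supremum `δ`. -/
def IsLadder (d : ℕ → α) (δ : α) : Prop := StrictMono d ∧ IsLUB (range d) δ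

/-- The largest element of `E` that is at most `i`, for a club `E`; it is `⊥` if there is none. -/
noncomputable def project [Nonempty α] (E : Set α) (i : α) : α := sSup (E ∩ Iic i)

theorem project_le_project [Nonempty α] {E F : Set α} (h : E ⊆ F) (i : α) : project E i ≤ project F i :=
  csSup_le_csSup' ⟨i, fun _ hx => hx.2⟩ (inter_subset_inter_left _ h)

theorem le_project [Nonempty α] {E : Set α} {e i : α} (he : e ∈ E) (hi : e ≤ i) : e ≤ project E i :=
  le_csSup ⟨i, fun _ hx => hx.2⟩ ⟨he, hi⟩

theorem project_mem [Nonempty α] {E : Set α} (hE : IsClub E) {i : α} (h : project E i ≠ ⊥) :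
    project E i ∈ E := by
  rcases (E ∩ Iic i).eq_empty_or_nonempty with h0 | h0
  · exact absurd (by rw [project, h0, csSup_empty]) h
  · exact hE.csSup_mem inter_subset_left h0 ⟨i, fun _ hx => hx.2⟩

/-- In a well-order of uncountable cofinality every club set has a limit point carrying a ladder. -/
theorem exists_isLadder_isLimitPoint (hα : ℵ₀ < cof α) {F : Set α} (hF : IsClub F) :
    ∃ δ, (∃ d, IsLadder d δ) ∧ IsLimitPoint F δ := by
  have := noMaxOrder_of_aleph0_lt_cof hα
  have : Nonempty α := cof_ne_zero_iff.1 (aleph0_pos.trans hα).ne'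
  have hstep : ∀ a : α, ∃ b ∈ F, a < b := fun a => by
    obtain ⟨a', ha'⟩ := exists_gt a
    obtain ⟨b, hb, hab⟩ := hF.isCofinal a'
    exact ⟨b, hb, ha'.trans_le hab⟩
  choose s hsF hs using hstep
  let t : ℕ → α := fun n => s^[n + 1] ⊥
  have htF : ∀ n, t n ∈ F := fun n => by
    simp only [t, Function.iterate_succ_apply']; exact hsF _
  have htm : StrictMono t := strictMono_nat_of_lt_succ fun n => by
    simp only [t, Function.iterate_succ_apply' s (n + 1)]; exact hs _
  have hb := bddAbove_range_of_aleph0_lt_cof hα t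
  have hl : IsLUB (range t) (sSup (range t)) := isLUB_csSup (range_nonempty _) hb
  refine ⟨sSup (range t), ⟨t, htm, hl⟩, fun a ha => ?_⟩
  obtain ⟨_, ⟨n, rfl⟩, hn⟩ := (lt_isLUB_iff hl).1 ha
  exact ⟨t n, htF n, hn, (htm n.lt_succ_self).trans_le (hl.1 ⟨n + 1, rfl⟩)⟩

/-- The main step of club guessing: for a fixed choice `d` of ladders, there is a club `E` such
that the ladders projected to `E` guess every club.  Otherwise the failure could be iterated `ω₁`
times, yielding a decreasing sequence of clubs; at a limit point of their intersection each of the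
countably many projections decreases along the sequence, hence they are all constant from a common
stage on, which contradicts the failure at that stage. -/
theorem exists_club_project_guess (hα : ℵ₁ < cof α) [Nonempty α] (d : α → ℕ → α)
    (hd : ∀ δ, (∃ e, IsLadder e δ) → IsLadder (d δ) δ) :
    ∃ E : Set α, IsClub E ∧ ∀ E', IsClub E' → ∃ δ, IsLadder (d δ) δ ∧ IsLimitPoint E δ ∧
      ∀ n, project E (d δ n) ≠ ⊥ → project E (d δ n) ∈ E' := by
  by_contra! H
  have h0 : ℵ₀ < cof α := aleph0_lt_aleph_one.trans hα
  have H' : ∀ E : Set α, ∃ E', IsClub E → IsClub E' ∧ ∀ δ, IsLadder (d δ) δ → IsLimitPoint E δ →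
      ∃ n, project E (d δ n) ≠ ⊥ ∧ project E (d δ n) ∉ E' := fun E => by
    by_cases hE : IsClub E
    · obtain ⟨E', h⟩ := H E hE
      exact ⟨E', fun _ => h⟩
    · exact ⟨∅, fun h => absurd h hE⟩
  choose G hG using H'
  -- the clubs `E i`, for `i < ω₁`, each contained in the clubs `G (E j)` that `E j` fails to guess
  let Ω : Type := (ℵ₁ : Cardinal.{0}).ord.ToType
  have hΩ : cof Ω = ℵ₁ := by
    rw [Ordinal.cof_toType, isRegular_aleph_one.cof_ord]
  have hΩ0 : ℵ₀ < cof Ω := by rw [hΩ]; exact aleph0_lt_aleph_one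
  have := noMaxOrder_of_aleph0_lt_cof hΩ0
  have : Nonempty Ω := cof_ne_zero_iff.1 (aleph0_pos.trans hΩ0).ne'
  let E : Ω → Set α := WellFounded.fix (C := fun _ => Set α) (wellFounded_lt (α := Ω))
    fun i e => ⋂ j : Iio i, G (e j.1 j.2)
  have hE : ∀ i, E i = ⋂ j : Iio i, G (E j.1) := fun i => WellFounded.fix_eq _ _ i
  have hanti : ∀ {i j}, i ≤ j → E j ⊆ E i := fun {i j} hij => by
    rw [hE i, hE j]
    exact fun x hx => mem_iInter.2 fun k => mem_iInter.1 hx ⟨k.1, k.2.trans_le hij⟩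
  have hclub : ∀ i, IsClub (E i) := fun i => by
    induction i using WellFoundedLT.induction with
    | ind i ih =>
      have : Countable (Iio i) := by
        have h : #(Iio i) < #Ω := mk_Iio_lt i (by rw [mk_toType, card_ord, Ordinal.type_toType])
        rw [mk_toType, card_ord, lt_aleph_one_iff] at h
        exact mk_le_aleph0_iff.1 h
      rw [hE]
      exact .iInter_of_countable h0.ne' fun j => (hG _ (ih j.1 j.2)).1
  have hF : IsClub (⋂ i, E i) := by
    refine .iInter h0.ne' ?_ hclub
    rw [mk_toType, card_ord]
    simpa using hα
  obtain ⟨δ, hδ, hlim⟩ := exists_isLadder_isLimitPoint h0 hF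
  have hlad := hd δ hδ
  -- the projections decrease with the stage, hence are eventually constant
  have hst : ∀ n, ∃ i, ∀ j, i ≤ j → project (E j) (d δ n) = project (E i) (d δ n) := fun n => by
    obtain ⟨_, ⟨i, rfl⟩, hi⟩ := WellFounded.has_min (wellFounded_lt (α := α))
      (range fun i => project (E i) (d δ n)) (range_nonempty _)
    exact ⟨i, fun j hij => le_antisymm (project_le_project (hanti hij) _) (not_lt.1 (hi _ ⟨j, rfl⟩))⟩
  choose i hi using hst
  obtain ⟨m, hm⟩ := bddAbove_range_of_aleph0_lt_cof hΩ0 i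
  obtain ⟨m', hmm'⟩ := exists_gt m
  have hlim' : IsLimitPoint (E m) δ := fun a ha => by
    obtain ⟨e, he, h⟩ := hlim a ha
    exact ⟨e, mem_iInter.1 he m, h⟩
  obtain ⟨n, hn, hn'⟩ := (hG _ (hclub m)).2 δ hlad hlim'
  have him : i n ≤ m := hm ⟨n, rfl⟩
  have heq : project (E m') (d δ n) = project (E m) (d δ n) :=
    (hi n m' (him.trans hmm'.le)).trans (hi n m him).symm
  rw [← heq] at hn hn'
  have := (hE m').subset (project_mem (hclub m') hn)
  exact hn' (mem_iInter.1 this ⟨m, hmm'⟩)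

/-- **Club guessing** for sequences of length `ω`: in a well-order of cofinality greater than `ℵ₁`
there is a family of sequences, indexed by the points, such that every club set contains all the
terms of some strictly increasing member of the family. -/
theorem exists_club_guessing (hα : ℵ₁ < cof α) :
    ∃ c : α → ℕ → α, ∀ E : Set α, IsClub E → ∃ δ, StrictMono (c δ) ∧ ∀ n, c δ n ∈ E := by
  have : Nonempty α := cof_ne_zero_iff.1 ((aleph_pos 1).trans hα).ne'
  have hd : ∀ δ : α, ∃ d : ℕ → α, (∃ e, IsLadder e δ) → IsLadder d δ := fun δ => by
    by_cases h : ∃ e, IsLadder e δ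
    · exact ⟨h.choose, fun _ => h.choose_spec⟩
    · exact ⟨fun _ => δ, fun h' => absurd h' h⟩
  choose d hd using hd
  obtain ⟨E, -, hguess⟩ := exists_club_project_guess hα d hd
  have hc : ∀ δ, ∃ c : ℕ → α, IsLadder (d δ) δ → IsLimitPoint E δ →
      StrictMono c ∧ ∀ k, c k ≠ ⊥ ∧ ∃ n, c k = project E (d δ n) := fun δ => by
    by_cases h : IsLadder (d δ) δ ∧ IsLimitPoint E δ
    · have hex : ∀ n, ∃ m, project E (d δ n) < project E (d δ m) := fun n => by
        have hlt : project E (d δ n) < δ := by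
          refine lt_of_le_of_lt (csSup_le' fun x hx => hx.2) ?_
          exact (h.1.1 n.lt_succ_self).trans_le (h.1.2.1 ⟨n + 1, rfl⟩)
        obtain ⟨e, he, hne, heδ⟩ := h.2 _ hlt
        obtain ⟨_, ⟨m, rfl⟩, hm⟩ := (lt_isLUB_iff h.1.2).1 heδ
        exact ⟨m, hne.trans_le (le_project he hm.le)⟩
      obtain ⟨g, hg, hg0⟩ := exists_strictMono_subseq_of_forall_exists_lt hex
      exact ⟨_, fun _ _ => ⟨hg, fun k => ⟨(bot_le.trans_lt (hg0 k)).ne', g k, rfl⟩⟩⟩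
    · exact ⟨fun _ => δ, fun h₁ h₂ => absurd ⟨h₁, h₂⟩ h⟩
  choose c hc using hc
  refine ⟨c, fun E' hE' => ?_⟩
  obtain ⟨δ, hδ, hlim, hmem⟩ := hguess E' hE'
  refine ⟨δ, (hc δ hδ hlim).1, fun k => ?_⟩
  obtain ⟨hk, n, hn⟩ := (hc δ hδ hlim).2 k
  rw [hn] at hk ⊢
  exact hmem n hk

end ClubGuessing

end UniversalModels

namespace UniversalModels

open Cardinal Order Set

/-! ### Linear orders without increasing maps into a given order -/

section Chains

theorem exists_mem_forall_lt_of_isLUB {α : Type*} [LinearOrder α] {s : Set α} {x : α}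
    (hx : IsLUB s x) (hs : s.Nonempty) {l : List α} (hl : ∀ y ∈ l, y < x) :
    ∃ b ∈ s, ∀ y ∈ l, y < b := by
  induction l with
  | nil => exact ⟨_, hs.some_mem, by simp⟩
  | cons y l ih =>
    obtain ⟨b, hb, hlb⟩ := ih fun z hz => hl z (List.mem_cons_of_mem _ hz)
    obtain ⟨b', hb', hyb'⟩ := (lt_isLUB_iff hx).1 (hl y List.mem_cons_self)
    refine ⟨max b b', by rcases max_choice b b' with h | h <;> rwa [h], fun z hz => ?_⟩
    rcases List.mem_cons.1 hz with rfl | hz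
    · exact lt_max_of_lt_right hyb'
    · exact lt_max_of_lt_left (hlb z hz)

attribute [local instance]
  WellFoundedLT.toOrderBot WellFoundedLT.conditionallyCompleteLinearOrderBot

/-- In a well-order whose proper initial segments are smaller than its uncountable cofinality, the
points closed under a partial function on finite sequences form a club. -/
theorem isClub_setOf_closed {α : Type u} [LinearOrder α] [WellFoundedLT α] (hα : ℵ₀ < cof α)
    (hsmall : ∀ a : α, #(Iic a) < cof α) (P : List α → α → Prop)
    (hP : ∀ l ξ ξ', P l ξ → P l ξ' → ξ = ξ') :
    IsClub {i | (∃ a, a < i) ∧ ∀ l, (∀ x ∈ l, x < i) → ∀ ξ, P l ξ → ξ < i} := by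
  have := noMaxOrder_of_aleph0_lt_cof hα
  have : Nonempty α := cof_ne_zero_iff.1 (aleph0_pos.trans hα).ne'
  have hbd : ∀ a : α, ∃ b, a < b ∧ ∀ l, (∀ x ∈ l, x ≤ a) → ∀ ξ, P l ξ → ξ < b := fun a => by
    -- a bound for the values at finite sequences from `Iic a`; there are fewer than `cof α` of them
    let T : Set α := {ξ | ∃ l : List (Iic a), P (l.map Subtype.val) ξ}
    have hT : #T ≤ #(List (Iic a)) := by
      refine mk_le_of_injective (f := fun ξ : T => ξ.2.choose) fun ξ ξ' h => Subtype.ext ?_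
      have h1 := ξ.2.choose_spec
      have h2 := ξ'.2.choose_spec
      simp only at h
      rw [← h] at h2
      exact hP _ _ _ h1 h2
    have hTb : BddAbove T := .of_not_isCofinal fun h => (cof_le h).not_gt <|
      hT.trans_lt ((mk_list_le_max _).trans_lt (max_lt hα (hsmall a)))
    obtain ⟨b, hb⟩ := hTb
    obtain ⟨b', hb'⟩ := exists_gt (max a b)
    refine ⟨b', (le_max_left _ _).trans_lt hb', fun l hl ξ hξ => ?_⟩
    refine (hb ?_).trans_lt ((le_max_right _ _).trans_lt hb')
    lift l to List (Iic a) using hl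
    exact ⟨l, hξ⟩
  refine ⟨fun s hs hs0 _ x hx => ⟨?_, fun l hl ξ hξ => ?_⟩, fun a => ?_⟩
  · obtain ⟨b, hb⟩ := hs0
    obtain ⟨a, ha⟩ := (hs hb).1
    exact ⟨a, ha.trans_le (hx.1 hb)⟩
  · obtain ⟨b, hb, hlb⟩ := exists_mem_forall_lt_of_isLUB hx hs0 hl
    exact ((hs hb).2 l hlb ξ hξ).trans_le (hx.1 hb)
  · choose s hs hsP using hbd
    let t : ℕ → α := fun n => s^[n] a
    have htm : StrictMono t := strictMono_nat_of_lt_succ fun n => by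
      simp only [t, Function.iterate_succ_apply' s n]; exact hs _
    have hl : IsLUB (range t) (sSup (range t)) :=
      isLUB_csSup (range_nonempty _) (bddAbove_range_of_aleph0_lt_cof hα t)
    refine ⟨sSup (range t), ⟨⟨t 0, ?_⟩, fun l hl' ξ hξ => ?_⟩, hl.1 ⟨0, rfl⟩⟩
    · exact (htm Nat.zero_lt_one).trans_le (hl.1 ⟨1, rfl⟩)
    · obtain ⟨_, ⟨n, rfl⟩, hn⟩ := exists_mem_forall_lt_of_isLUB hl (range_nonempty _) hl'
      refine (hsP (t n) l (fun x hx => (hn x hx).le) ξ hξ).trans_le (hl.1 ⟨n + 1, ?_⟩)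
      simp only [t, Function.iterate_succ_apply' s n]

/-- The point `(r s₀, …, r sₖ₋₁, q, 0, 0, …)` of the lexicographically ordered set of sequences of
reals, for a finite sequence `s` and a rational number `q`. -/
noncomputable def node {I : Type u} (r : I → ℝ) (s : List I) (q : ℚ) : Lex (ℕ → ℝ) :=
  toLex fun n => (s.map r ++ [(q : ℝ)]).getD n 0

/-- The strictly increasing sequence of naturals coding `b`: its `k`-th term is `2 k` or `2 k + 1`
according to `b k`. -/
def code (b : ℕ → Bool) (k : ℕ) : ℕ := 2 * k + (b k).toNat

/-- The infinite sequence of reals that is the image under `r` of the subsequence of `c` coded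
by `b`. -/
def branch {I : Type u} (r : I → ℝ) (c : ℕ → I) (b : ℕ → Bool) : Lex (ℕ → ℝ) :=
  toLex fun k => r (c (code b k))

/-- The set of all sequences of reals with initial segment `r s₀, …, r sₖ₋₁`. -/
def cone {I : Type u} (r : I → ℝ) (s : List I) : Set (Lex (ℕ → ℝ)) :=
  {v | ∀ n (h : n < s.length), ofLex v n = r s[n]}

variable {I : Type u} {r : I → ℝ}

theorem node_mem_cone (s : List I) (q : ℚ) : node r s q ∈ cone r s := fun n h => by
  simp [node, List.getElem?_append_left, h]

theorem apply_length_of_mem_cone {s : List I} {ξ : I} {v : Lex (ℕ → ℝ)}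
    (h : v ∈ cone r (s ++ [ξ])) : ofLex v s.length = r ξ := by
  simpa using h s.length (by simp)

theorem cone_append_subset (s t : List I) : cone r (s ++ t) ⊆ cone r s := fun v hv n h => by
  rw [hv n (by simp; omega), List.getElem_append_left h]

theorem lt_of_mem_cone {s : List I} {v w : Lex (ℕ → ℝ)} (hv : v ∈ cone r s) (hw : w ∈ cone r s)
    (h : ofLex v s.length < ofLex w s.length) : v < w :=
  ⟨s.length, fun n hn => (hv n hn).trans (hw n hn).symm, h⟩

theorem node_apply_length (s : List I) (q : ℚ) : ofLex (node r s q) s.length = q := by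
  simp [node]

theorem lt_of_mem_cone_of_lt {s : List I} {ξ ξ' : I} {v w : Lex (ℕ → ℝ)}
    (hv : v ∈ cone r (s ++ [ξ])) (hw : w ∈ cone r (s ++ [ξ'])) (h : r ξ < r ξ') : v < w :=
  lt_of_mem_cone (cone_append_subset _ _ hv) (cone_append_subset _ _ hw) <| by
    rwa [apply_length_of_mem_cone hv, apply_length_of_mem_cone hw]

theorem node_lt_of_mem_cone {s : List I} {ξ : I} {v : Lex (ℕ → ℝ)} (hv : v ∈ cone r (s ++ [ξ]))
    {q : ℚ} (h : q < r ξ) : node r s q < v :=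
  lt_of_mem_cone (node_mem_cone _ _) (cone_append_subset _ _ hv) <| by
    rwa [node_apply_length, apply_length_of_mem_cone hv]

theorem lt_node_of_mem_cone {s : List I} {ξ : I} {v : Lex (ℕ → ℝ)} (hv : v ∈ cone r (s ++ [ξ]))
    {q : ℚ} (h : r ξ < q) : v < node r s q :=
  lt_of_mem_cone (cone_append_subset _ _ hv) (node_mem_cone _ _) <| by
    rwa [node_apply_length, apply_length_of_mem_cone hv]

/-- The first `k` terms of the subsequence of `c` coded by `b`. -/
def initialSegment (c : ℕ → I) (b : ℕ → Bool) (k : ℕ) : List I :=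
  (List.range k).map fun i => c (code b i)

theorem initialSegment_succ (c : ℕ → I) (b : ℕ → Bool) (k : ℕ) :
    initialSegment c b (k + 1) = initialSegment c b k ++ [c (code b k)] := by
  simp [initialSegment, List.range_succ]

theorem branch_mem_cone (c : ℕ → I) (b : ℕ → Bool) (k : ℕ) :
    branch r c b ∈ cone r (initialSegment c b k) := fun n h => by
  simp [branch, initialSegment]

variable {N : Type u} (R : N → N → Prop)

/-- The stage `n` is marked at `z`, relative to the enumeration `g` and the sequence `c`, if some
`w` enumerated before `c (n + 1)` lies above the same elements enumerated before `c n` as `z`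
does. -/
def Marked [LT I] (g : N → I) (c : ℕ → I) (z : N) (n : ℕ) : Prop :=
  ∃ w, g w < c (n + 1) ∧ ∀ u, g u < c n → (R u w ↔ R u z)

variable {R}

/-- A map that is strictly increasing on a set containing all nodes and the branch coded by `b`
lets one recover `b` from the marked stages of the image of that branch, for all sequences in some
club.  It suffices to look at the even stages: stage `2 * k` is one of the two positions that the
`k`-th term of the coded subsequence may have. -/
theorem exists_club_marked_iff [LinearOrder I] [WellFoundedLT I] (hI : ℵ₀ < cof I)
    (hsmall : ∀ a : I, #(Iic a) < cof I) (hr : Function.Injective r)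
    (htrans : ∀ {x y z}, R x y → R y z → R x z) (hirr : ∀ x, ¬ R x x)
    {g : N → I} (hg : Function.Injective g) {S : Set (Lex (ℕ → ℝ))} (hS : ∀ s q, node r s q ∈ S)
    {f : Lex (ℕ → ℝ) → N} (hf : ∀ x ∈ S, ∀ y ∈ S, x < y → R (f x) (f y)) :
    ∃ E : Set I, IsClub E ∧ ∀ c : ℕ → I, StrictMono c → (∀ n, c n ∈ E) → ∀ b, branch r c b ∈ S →
      ∀ k, (Marked R g c (f (branch r c b)) (2 * k) ↔ b k = false) := by
  have hmono : ∀ {u x y}, x ∈ S → y ∈ S → x < y → R u (f x) → R u (f y) :=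
    fun hx hy hxy h => htrans h (hf _ hx _ hy hxy)
  -- the cone of `s ++ [ξ]` is split by the upper cut of `u`
  let split : N → List I → I → Prop := fun u s ξ =>
    (∃ v ∈ S, v ∈ cone r (s ++ [ξ]) ∧ R u (f v)) ∧ ∃ v ∈ S, v ∈ cone r (s ++ [ξ]) ∧ ¬ R u (f v)
  -- `w` fills the cut `r ξ` in the copy of the rationals above `s`
  let cut : N → List I → I → Prop := fun w s ξ =>
    (∀ q : ℚ, q < r ξ → R (f (node r s q)) w) ∧ ∀ q : ℚ, r ξ < q → ¬ R (f (node r s q)) w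
  -- the cones above `s` are disjoint intervals, so an upper cut splits at most one of them
  have hsplit_lt : ∀ {u s ξ ξ'}, split u s ξ → split u s ξ' → ¬ r ξ < r ξ' := by
    rintro u s ξ ξ' ⟨⟨v, hv, hvc, huv⟩, -⟩ ⟨-, w, hw, hwc, huw⟩ hlt
    exact huw (hmono hv hw (lt_of_mem_cone_of_lt hvc hwc hlt) huv)
  -- `w` fills at most one cut, by density of the rationals
  have hcut_lt : ∀ {w s ξ ξ'}, cut w s ξ → cut w s ξ' → ¬ r ξ < r ξ' := by
    rintro w s ξ ξ' ⟨-, h1⟩ ⟨h2, -⟩ hlt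
    obtain ⟨q, hq, hq'⟩ := exists_rat_btwn hlt
    exact h1 q hq (h2 q hq')
  have hE1 := fun q : ℚ => isClub_setOf_closed hI hsmall (fun l ξ => ξ = g (f (node r l q)))
    fun l ξ ξ' h h' => h.trans h'.symm
  have hE2 := isClub_setOf_closed hI hsmall (fun l ξ => ∃ u s, l = g u :: s ∧ split u s ξ) (by
    rintro l ξ ξ' ⟨u, s, rfl, h⟩ ⟨u', s', h0, h'⟩
    rw [List.cons.injEq] at h0
    obtain ⟨h0, rfl⟩ := h0
    rw [← hg h0] at h'
    exact hr (le_antisymm (not_lt.1 (hsplit_lt h' h)) (not_lt.1 (hsplit_lt h h'))))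
  have hE3 := isClub_setOf_closed hI hsmall (fun l ξ => ∃ u s, l = g u :: s ∧ cut u s ξ) (by
    rintro l ξ ξ' ⟨u, s, rfl, h⟩ ⟨u', s', h0, h'⟩
    rw [List.cons.injEq] at h0
    obtain ⟨h0, rfl⟩ := h0
    rw [← hg h0] at h'
    exact hr (le_antisymm (not_lt.1 (hcut_lt h' h)) (not_lt.1 (hcut_lt h h'))))
  refine ⟨_, (IsClub.iInter_of_countable hI.ne' hE1).inter hI.ne' (hE2.inter hI.ne' hE3), ?_⟩
  intro c hc hcE b hb k
  have hE1 : ∀ n s q, (∀ x ∈ s, x < c n) → g (f (node r s q)) < c n := fun n s q hs =>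
    (mem_iInter.1 (hcE n).1 q).2 s hs _ rfl
  have hE2 : ∀ n u s ξ, g u < c n → (∀ x ∈ s, x < c n) → split u s ξ → ξ < c n :=
    fun n u s ξ hu hs h => (hcE n).2.1.2 (g u :: s) (by simpa [hu] using hs) ξ ⟨u, s, rfl, h⟩
  have hE3 : ∀ n u s ξ, g u < c n → (∀ x ∈ s, x < c n) → cut u s ξ → ξ < c n :=
    fun n u s ξ hu hs h => (hcE n).2.2.2 (g u :: s) (by simpa [hu] using hs) ξ ⟨u, s, rfl, h⟩
  have hseg : ∀ x ∈ initialSegment c b k, x < c (2 * k) := by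
    simp only [initialSegment, List.mem_map, List.mem_range]
    rintro _ ⟨i, hi, rfl⟩
    refine hc ?_
    have := (b i).toNat_le
    simp only [code]; omega
  have hbr : branch r c b ∈ cone r (initialSegment c b k ++ [c (code b k)]) :=
    initialSegment_succ c b k ▸ branch_mem_cone c b (k + 1)
  constructor
  · rintro ⟨w, hw, hwz⟩
    by_contra hbk
    have hcode : code b k = 2 * k + 1 := by simp [code, eq_true_of_ne_false hbk]
    rw [hcode] at hbr
    -- `w` would have to fill the cut of the branch, but that cut has the index `c (2 * k + 1)`
    refine lt_irrefl (c (2 * k + 1)) (hE3 _ w _ _ hw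
      (fun x hx => (hseg x hx).trans (hc (Nat.lt_succ_self _))) ⟨fun q hq => ?_, fun q hq h => ?_⟩)
    · exact (hwz _ (hE1 _ _ _ hseg)).2 (hf _ (hS _ _) _ hb (node_lt_of_mem_cone hbr hq))
    · exact hirr _ (htrans ((hwz _ (hE1 _ _ _ hseg)).1 h)
        (hf _ hb _ (hS _ _) (lt_node_of_mem_cone hbr hq)))
  · intro hbk
    have hcode : code b k = 2 * k := by simp [code, hbk]
    rw [hcode] at hbr
    -- the image of any node in the cone of the branch marks the stage, as no `u` enumerated before
    -- `c (2 * k)` splits that cone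
    refine ⟨f (node r (initialSegment c b k ++ [c (2 * k)]) 0), hE1 _ _ _ ?_, fun u hu => ?_⟩
    · intro x hx
      rcases List.mem_append.1 hx with hx | hx
      · exact (hseg x hx).trans (hc (Nat.lt_succ_self _))
      · rw [List.mem_singleton.1 hx]
        exact hc (Nat.lt_succ_self _)
    · by_contra hne
      refine lt_irrefl (c (2 * k)) (hE2 _ u _ _ hu hseg ?_)
      rcases not_iff.1 hne with h
      by_cases h1 : R u (f (branch r c b))
      · exact ⟨⟨_, hb, hbr, h1⟩, _, hS _ _, node_mem_cone _ _, fun h2 => (h.2 h1) h2⟩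
      · exact ⟨⟨_, hS _ _, node_mem_cone _ _, by_contra fun h2 => h1 (h.1 h2)⟩, _, hb, hbr, h1⟩

/-- For a strict order on a set of regular cardinality `κ` with `ℵ₁ < κ < 2 ^ ℵ₀` there is a linear
order of cardinality at most `κ` without a strictly increasing map into it.  With `M b` the set of
all nodes and of the branches coded by `b`, maps of all the `M b` would, by club guessing, yield an
injection `b ↦ (δ, f x)` of `2 ^ ℵ₀` into `κ × κ`, where `x` is the branch in `M b` along the
`δ`-th guessing sequence. -/
theorem exists_linearOrder_forall_not_strictMono {κ : Cardinal.{u}} (hreg : κ.IsRegular)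
    (h1 : ℵ₁ < κ) (h2 : κ < 2 ^ ℵ₀) (hN : #N ≤ κ)
    (htrans : ∀ {x y z}, R x y → R y z → R x z) (hirr : ∀ x, ¬ R x x) :
    ∃ (M : Type u) (_ : LinearOrder M), #M ≤ κ ∧
      ∀ f : M → N, ¬ ∀ x y, x < y → R (f x) (f y) := by
  let I : Type u := κ.ord.ToType
  have hI : #I = κ := by rw [mk_toType, card_ord]
  have hcof : cof I = κ := by rw [Ordinal.cof_toType, hreg.cof_ord]
  have h0 : ℵ₀ < κ := aleph0_lt_aleph_one.trans h1
  have hI0 : ℵ₀ < cof I := h0.trans_eq hcof.symm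
  have hsmall : ∀ a : I, #(Iic a) < cof I := fun a => by
    have := noMaxOrder_of_aleph0_lt_cof hI0
    obtain ⟨b, hb⟩ := exists_gt a
    have h : #(Iio b) < #I := mk_Iio_lt b (by rw [mk_toType, card_ord, Ordinal.type_toType])
    exact ((mk_le_mk_of_subset fun x hx => lt_of_le_of_lt hx hb).trans_lt h).trans_eq
      (hI.trans hcof.symm)
  obtain ⟨c, hc⟩ := exists_club_guessing (hcof.symm ▸ h1 : ℵ₁ < cof I)
  obtain ⟨r, hr⟩ : ∃ r : I → ℝ, Function.Injective r := by
    have : Cardinal.lift.{0} #I ≤ Cardinal.lift.{u} #ℝ := by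
      rw [hI, mk_real, lift_continuum, lift_uzero, ← two_power_aleph0]
      exact h2.le
    exact (lift_mk_le'.1 this).elim fun e => ⟨e, e.injective⟩
  obtain ⟨g, hg⟩ : ∃ g : N → I, Function.Injective g :=
    (Cardinal.le_def _ _).1 (hN.trans_eq hI.symm) |>.elim fun e => ⟨e, e.injective⟩
  let S : (ℕ → Bool) → Set (Lex (ℕ → ℝ)) := fun b =>
    range (Sum.elim (fun p : List I × ℚ => node r p.1 p.2) fun δ : I => branch r (c δ) b)
  by_contra! H
  have hS : ∀ b, #(ULift.{u} (S b)) ≤ κ := fun b => by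
    rw [mk_uLift]
    refine (mk_range_le_lift (α := List I × ℚ ⊕ I)).trans ?_
    have : Infinite I := infinite_iff.2 (hI.symm ▸ h0.le)
    simp [mk_list_eq_mk, hI, h0.le, add_eq_self h0.le]
  have hf : ∀ b, ∃ f : Lex (ℕ → ℝ) → N, ∀ x ∈ S b, ∀ y ∈ S b, x < y → R (f x) (f y) := fun b => by
    obtain ⟨f, hf⟩ := H (ULift.{u} (S b))
      (LinearOrder.lift' ULift.down ULift.down_injective) (hS b)
    have : Nonempty N := ⟨f ⟨⟨node r [] 0, Sum.inl ([], 0), rfl⟩⟩⟩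
    classical
    refine ⟨fun x => if h : x ∈ S b then f ⟨⟨x, h⟩⟩ else Classical.arbitrary N, ?_⟩
    intro x hx y hy hxy
    simp only [dif_pos hx, dif_pos hy]
    exact hf _ _ hxy
  choose f hf using hf
  -- for each `b`, the index `δ b` of a guessing sequence from which `b` can be recovered
  have hE := fun b => exists_club_marked_iff hI0 hsmall hr htrans hirr hg
    (R := R) (S := S b) (fun s q => ⟨Sum.inl (s, q), rfl⟩) (hf b)
  choose E hE hEb using hE
  choose δ hδ hδE using fun b => hc (E b) (hE b)
  have hinj : Function.Injective fun b => (δ b, f b (branch r (c (δ b)) b)) := fun b b' h => by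
    obtain ⟨h3, h4⟩ := Prod.mk.inj h
    funext k
    have k1 := hEb b (c (δ b)) (hδ b) (hδE b) b ⟨Sum.inr (δ b), rfl⟩ k
    have k2 := hEb b' (c (δ b')) (hδ b') (hδE b') b' ⟨Sum.inr (δ b'), rfl⟩ k
    rw [← h4, ← h3, k1] at k2
    rcases hb : b k <;> rcases hb' : b' k <;> simp_all
  have := lift_mk_le_lift_mk_of_injective hinj
  simp only [mk_prod, hI, lift_id, mk_pi, mk_bool, prod_const, mk_nat, lift_uzero,
    two_power_aleph0] at this
  rw [two_power_aleph0, ← lift_continuum.{u, 0}] at h2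
  exact ((this.trans (mul_le_mul_right hN κ)).trans_eq (mul_eq_self h0.le)).not_gt h2

end Chains

end UniversalModels

namespace UniversalModels

open Cardinal Order Set

/-! ### Orders, lattices, Boolean algebras, ordered fields and groups -/

section OrdinaryEmbeddings

variable {κ : Cardinal.{u}}

theorem not_hasUniversalPartialOrder (hreg : κ.IsRegular) (h1 : ℵ₁ < κ) (h2 : κ < 2 ^ ℵ₀) :
    ¬ HasUniversalPartialOrder κ := by
  rintro ⟨P, _, hP, h⟩
  obtain ⟨M, _, hM, hf⟩ := exists_linearOrder_forall_not_strictMono (R := ((· < ·) : P → P → Prop))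
    hreg h1 h2 hP.le lt_trans lt_irrefl
  obtain ⟨f⟩ := h M hM
  exact hf f fun _ _ hxy => f.lt_iff_lt.2 hxy

/-- An injective lattice homomorphism is strictly increasing. -/
theorem strictMono_of_latticeHom {F A B : Type*} [Lattice A] [Lattice B] [FunLike F A B]
    [LatticeHomClass F A B] {f : F} (hf : Function.Injective f) : StrictMono f :=
  (OrderHomClass.mono f).strictMono_of_injective hf

theorem not_hasUniversalLattice (hreg : κ.IsRegular) (h1 : ℵ₁ < κ) (h2 : κ < 2 ^ ℵ₀) :
    ¬ HasUniversalLattice κ := by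
  rintro ⟨A, _, hA, h⟩
  obtain ⟨M, _, hM, hf⟩ := exists_linearOrder_forall_not_strictMono (R := ((· < ·) : A → A → Prop))
    hreg h1 h2 hA.le lt_trans lt_irrefl
  obtain ⟨f, hinj⟩ := h M hM
  exact hf f fun _ _ hxy => strictMono_of_latticeHom hinj hxy

/-- The generators of the interval algebra of a linear order: the principal lower sets together
with the empty set and the whole order. -/
def initialSets (M : Type u) [LinearOrder M] : Set (Set M) := insert ⊥ (insert ⊤ (range Iic))

theorem isSublattice_initialSets (M : Type u) [LinearOrder M] : IsSublattice (initialSets M) := by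
  have htot : ∀ x ∈ initialSets M, ∀ y ∈ initialSets M, x ≤ y ∨ y ≤ x := by
    rintro x (rfl | rfl | ⟨a, rfl⟩) y (rfl | rfl | ⟨b, rfl⟩) <;> try simp
    simpa using le_total a b
  refine ⟨fun x hx y hy => ?_, fun x hx y hy => ?_⟩
  · rcases htot x hx y hy with h | h
    · rwa [sup_eq_right.2 h]
    · rwa [sup_eq_left.2 h]
  · rcases htot x hx y hy with h | h
    · rwa [inf_eq_left.2 h]
    · rwa [inf_eq_right.2 h]

theorem mk_finset_le_max (α : Type u) : #(Finset α) ≤ max ℵ₀ #α := by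
  classical
  exact (mk_le_of_surjective (f := List.toFinset (α := α)) List.toFinset_surjective).trans
    (mk_list_le_max α)

theorem mk_closure_initialSets_le (M : Type u) [LinearOrder M] :
    #(BooleanSubalgebra.closure (initialSets M)) ≤ max ℵ₀ #M := by
  let F : Finset (initialSets M × initialSets M) → Set M := fun t => t.sup fun x => x.1.1 \ x.2.1
  have hsub : (BooleanSubalgebra.closure (initialSets M) : Set (Set M)) ⊆ range F := fun x hx => by
    obtain ⟨t, ht⟩ := (BooleanSubalgebra.mem_closure_iff_sup_sdiff (isSublattice_initialSets M)
      (mem_insert _ _) (mem_insert_of_mem _ (mem_insert _ _))).1 hx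
    exact ⟨t, ht.symm⟩
  have hgen : #(initialSets M) ≤ max ℵ₀ #M := by
    refine mk_insert_le.trans (add_le_of_le (le_max_left _ _) ?_ ?_)
    · refine mk_insert_le.trans (add_le_of_le (le_max_left _ _) ?_ ?_)
      · exact mk_range_le.trans (le_max_right _ _)
      · exact one_le_aleph0.trans (le_max_left _ _)
    · exact one_le_aleph0.trans (le_max_left _ _)
  refine (mk_le_mk_of_subset hsub).trans (mk_range_le.trans ((mk_finset_le_max _).trans ?_))
  rw [mk_prod, lift_id]
  refine max_le (le_max_left _ _) ?_
  exact (mul_le_mul' hgen hgen).trans_eq (mul_eq_self (le_max_left _ _))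

theorem not_hasUniversalBooleanAlgebra (hreg : κ.IsRegular) (h1 : ℵ₁ < κ) (h2 : κ < 2 ^ ℵ₀) :
    ¬ HasUniversalBooleanAlgebra κ := by
  rintro ⟨A, _, _, hA, h⟩
  obtain ⟨M, _, hM, hf⟩ := exists_linearOrder_forall_not_strictMono (R := ((· < ·) : A → A → Prop))
    hreg h1 h2 hA.le lt_trans lt_irrefl
  -- on an empty order the interval algebra would be trivial
  have : Nonempty M := not_isEmpty_iff.1 fun h => hf (fun x => h.elim x) fun x => h.elim x
  let B := BooleanSubalgebra.closure (initialSets M)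
  have : Nontrivial B := ⟨⟨⊥, ⊤, fun h => bot_ne_top (α := Set M) (congrArg Subtype.val h)⟩⟩
  obtain ⟨f, hinj⟩ := h B ((mk_closure_initialSets_le M).trans
    (max_le (aleph0_lt_aleph_one.trans h1).le hM))
  refine hf (fun x => f ⟨Iic x, BooleanSubalgebra.subset_closure (.inr (.inr ⟨x, rfl⟩))⟩)
    fun x y hxy => strictMono_of_latticeHom hinj ?_
  exact Set.Iic_ssubset_Iic.2 hxy

/-- A fine ultrafilter: on the finite subsets of `M` there is an ultrafilter containing, for each `x`, the family of
those that have `x` as an element. -/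
theorem exists_ultrafilter_eventually_mem (M : Type u) :
    ∃ U : Ultrafilter (Finset M), ∀ x, ∀ᶠ s in (U : Filter (Finset M)), x ∈ s := by
  classical
  refine ⟨Ultrafilter.of Filter.atTop, fun x => ?_⟩
  refine (Filter.eventually_ge_atTop {x}).filter_mono (Ultrafilter.of_le _) |>.mono fun s hs => ?_
  exact hs (Finset.mem_singleton_self x)

/-- The number of elements of the finite set `s` below `x`. -/
noncomputable def rankIn {M : Type u} [LinearOrder M] (x : M) (s : Finset M) : ℕ :=
  (s.filter (· < x)).card

theorem rankIn_lt_rankIn {M : Type u} [LinearOrder M] {x y : M} (h : x < y) {s : Finset M}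
    (hx : x ∈ s) : rankIn x s < rankIn y s := by
  refine Finset.card_lt_card (Finset.ssubset_iff_of_subset ?_ |>.2 ⟨x, by simp [hx, h], by simp⟩)
  exact fun z hz => by
    simp only [Finset.mem_filter] at hz ⊢
    exact ⟨hz.1, hz.2.trans h⟩

/-- Every linear order embeds into an ordered field of no larger infinite cardinality, namely into
a subfield of an ultrapower of `ℚ` over the finite subsets of the order. -/
theorem exists_orderedField_strictMono (M : Type u) [LinearOrder M] :
    ∃ (E : Type u) (_ : Field E) (_ : LinearOrder E) (_ : IsStrictOrderedRing E),
      #E ≤ max #M ℵ₀ ∧ ∃ f : M → E, StrictMono f := by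
  obtain ⟨U, hU⟩ := exists_ultrafilter_eventually_mem M
  let K : Type u := (U : Filter (Finset M)).Germ ℚ
  let a : M → K := fun x => ((fun s => (rankIn x s : ℚ) : Finset M → ℚ) : K)
  have ha : StrictMono a := fun x y hxy => Filter.Germ.coe_lt.2 <|
    (hU x).mono fun s hs => Nat.cast_lt.2 (rankIn_lt_rankIn hxy hs)
  refine ⟨Subfield.closure (range a), inferInstance, inferInstance, inferInstance, ?_,
    fun x => ⟨a x, Subfield.subset_closure ⟨x, rfl⟩⟩, fun x y hxy => ha hxy⟩
  exact (Subfield.cardinalMk_closure_le_max _).trans (max_le_max mk_range_le le_rfl)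

theorem not_hasUniversalOrderedField (hreg : κ.IsRegular) (h1 : ℵ₁ < κ) (h2 : κ < 2 ^ ℵ₀) :
    ¬ HasUniversalOrderedField κ := by
  rintro ⟨F, _, _, _, hF, h⟩
  obtain ⟨M, _, hM, hf⟩ := exists_linearOrder_forall_not_strictMono (R := ((· < ·) : F → F → Prop))
    hreg h1 h2 hF.le lt_trans lt_irrefl
  obtain ⟨E, _, _, _, hE, a, ha⟩ := exists_orderedField_strictMono M
  obtain ⟨f, hmono⟩ := h E (hE.trans (max_le hM (aleph0_lt_aleph_one.trans h1).le))
  exact hf (f ∘ a) (hmono.comp ha)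

theorem not_hasUniversalOrderedGroup (hreg : κ.IsRegular) (h1 : ℵ₁ < κ) (h2 : κ < 2 ^ ℵ₀) :
    ¬ HasUniversalOrderedGroup κ := by
  rintro ⟨G, _, _, _, _, hG, h⟩
  obtain ⟨M, _, hM, hf⟩ := exists_linearOrder_forall_not_strictMono (R := ((· < ·) : G → G → Prop))
    hreg h1 h2 hG.le lt_trans lt_irrefl
  obtain ⟨E, _, _, _, hE, a, ha⟩ := exists_orderedField_strictMono M
  obtain ⟨f, hmono⟩ := h (Multiplicative E)
    (hE.trans (max_le hM (aleph0_lt_aleph_one.trans h1).le))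
  exact hf (f ∘ Multiplicative.ofAdd ∘ a) (hmono.comp ha)

theorem not_hasUniversalOrderedCommGroup (hreg : κ.IsRegular) (h1 : ℵ₁ < κ) (h2 : κ < 2 ^ ℵ₀) :
    ¬ HasUniversalOrderedCommGroup κ := by
  rintro ⟨G, _, _, _, hG, h⟩
  obtain ⟨M, _, hM, hf⟩ := exists_linearOrder_forall_not_strictMono (R := ((· < ·) : G → G → Prop))
    hreg h1 h2 hG.le lt_trans lt_irrefl
  obtain ⟨E, _, _, _, hE, a, ha⟩ := exists_orderedField_strictMono M
  obtain ⟨f, hmono⟩ := h (Multiplicative E)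
    (hE.trans (max_le hM (aleph0_lt_aleph_one.trans h1).le))
  exact hf (f ∘ Multiplicative.ofAdd ∘ a) (hmono.comp ha)

end OrdinaryEmbeddings

end UniversalModels

namespace UniversalModels

open Cardinal Order Set FirstOrder

/-! ### Chains in models of first-order theories -/

section ElementaryEmbeddings

/-- If a countable theory has a model with an infinite `φ`-increasing sequence, then every linear
order `M` is represented by a `φ`-increasing map into some model of cardinality at most
`max ℵ₀ #M`. -/
theorem exists_model_chain {L : FirstOrder.Language.{0, 0}} (hL : L.card ≤ ℵ₀) (T : L.Theory)
    (φ : L.Formula (Fin 2)) (A : Language.Theory.ModelType.{0, 0, v} T) (a : ℕ → A)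
    (ha : ∀ i j, i < j → φ.Realize ![a i, a j]) (M : Type u) [LinearOrder M] :
    ∃ E : Language.Theory.ModelType.{0, 0, max u v} T, #E ≤ max ℵ₀ (Cardinal.lift.{v} #M) ∧
      ∃ f : M → E, ∀ x y, x < y → φ.Realize ![f x, f y] := by
  obtain ⟨U, hU⟩ := exists_ultrafilter_eventually_mem M
  let P : Type (max u v) := (U : Filter (Finset M)).Product fun _ => (A : Type v)
  let g : M → P := fun x => (fun s => a (rankIn x s) : Finset M → A)
  have hg : ∀ x y, x < y → φ.Realize ![g x, g y] := fun x y hxy => by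
    have h := (Language.Ultraproduct.realize_formula_cast (u := U) (M := fun _ => (A : Type v)) φ
      ![fun s => a (rankIn x s), fun s => a (rankIn y s)]).2 <| (hU x).mono fun s hs => by
        convert! ha _ _ (rankIn_lt_rankIn hxy hs) using 1
        funext i; fin_cases i <;> rfl
    convert! h using 1
    funext i; fin_cases i <;> rfl
  have hP : P ⊨ T := ⟨fun ψ hψ => (Language.Ultraproduct.sentence_realize ψ).2 <|
    Filter.Eventually.of_forall fun _ => Language.Theory.realize_sentence_of_mem T hψ⟩
  have : Nonempty P := Language.Ultraproduct.Product.instNonempty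
  -- a finite ultrapower is already small; otherwise take an elementary substructure
  rcases lt_or_ge #P ℵ₀ with hfin | hinf
  · exact ⟨.of T P, hfin.le.trans (le_max_left _ _), g, hg⟩
  obtain ⟨S, hS, hcard⟩ := Language.exists_elementarySubstructure_card_eq L (range g)
    (max ℵ₀ #(range g)) (le_max_left _ _) (by simp)
    (by simpa using Or.inl hL) (by simpa using ⟨hinf, mk_set_le _⟩)
  refine ⟨.of T S, ?_, fun x => ⟨g x, hS ⟨x, rfl⟩⟩, fun x y hxy => ?_⟩
  · have hr : #(range g) ≤ Cardinal.lift.{v} #M := by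
      rw [← lift_umax.{u, v}, ← lift_id'.{u, max u v} #(range g)]
      exact mk_range_le_lift (f := g)
    rw [lift_id, lift_id] at hcard
    exact hcard.trans_le (max_le_max le_rfl hr)
  · refine (S.subtype.map_formula φ _).1 ?_
    convert! hg x y hxy using 1
    funext i; fin_cases i <;> rfl

/-- A theory has no universal model in `κ` if some formula `φ` defines a strict partial order in
each of its models, and every small linear order is represented by a `φ`-increasing map into some
small model. -/
theorem not_hasElementaryUniversalModel {L : FirstOrder.Language.{0, 0}} {T : L.Theory} {κ : Cardinal.{u}}
    (hreg : κ.IsRegular) (h1 : ℵ₁ < κ) (h2 : κ < 2 ^ ℵ₀) (φ : L.Formula (Fin 2))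
    (htrans : ∀ (N : Language.Theory.ModelType.{0, 0, u} T) (x y z : N), φ.Realize ![x, y] →
      φ.Realize ![y, z] → φ.Realize ![x, z])
    (hirr : ∀ (N : Language.Theory.ModelType.{0, 0, u} T) (x : N), ¬ φ.Realize ![x, x])
    (hchain : Language.Theory.ModelType.{0, 0, u} T → ∀ (M : Type u) [LinearOrder M],
      ∃ E : Language.Theory.ModelType.{0, 0, u} T, #E ≤ max ℵ₀ #M ∧
        ∃ f : M → E, ∀ x y, x < y → φ.Realize ![f x, f y]) :
    ¬ HasElementaryUniversalModel T κ := by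
  rintro ⟨N, hN, h⟩
  obtain ⟨M, _, hM, hf⟩ := exists_linearOrder_forall_not_strictMono
    (R := fun x y : N => φ.Realize ![x, y]) hreg h1 h2 hN.le (htrans N _ _ _) (hirr N)
  obtain ⟨E, hE, a, ha⟩ := hchain N M
  obtain ⟨e⟩ := h E (hE.trans (max_le (aleph0_lt_aleph_one.trans h1).le hM))
  refine hf (e ∘ a) fun x y hxy => ?_
  have := (e.map_formula φ _).2 (ha x y hxy)
  convert! this using 1
  funext i; fin_cases i <;> rfl

end ElementaryEmbeddings

/-! ### Peano arithmetic -/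

section Arithmetic

/-- The formula `∃ z, x₀ + S z = x₁`, the strict order of arithmetic. -/
def ltFormula : arith.Formula (Fin 2) :=
  Language.BoundedFormula.ex (n := 0) (Language.Term.bdEqual
    (tAdd (Language.Term.var (Sum.inl 0)) (tSucc (Language.Term.var (Sum.inr 0))))
    (Language.Term.var (Sum.inl 1)))

theorem card_arith_le : arith.card ≤ ℵ₀ := by
  have : Countable arith.Symbols := by
    have : Countable (Σ n, arith.Functions n) := by
      refine Function.Injective.countable (β := ℕ) (f := fun x => match x with
        | ⟨_, ArithFunc.zero⟩ => 0
        | ⟨_, ArithFunc.succ⟩ => 1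
        | ⟨_, ArithFunc.add⟩ => 2
        | ⟨_, ArithFunc.mul⟩ => 3) ?_
      rintro ⟨_, _ | _ | _ | _⟩ ⟨_, _ | _ | _ | _⟩ h <;> simp_all
    have : IsEmpty (Σ n, arith.Relations n) := ⟨fun x => nomatch x.2⟩
    exact inferInstanceAs (Countable (_ ⊕ _))
  exact mk_le_aleph0

variable {A : Type u} [arith.Structure A]

variable (A) in
/-- The interpretation of `0`. -/
def zeroIn : A := Language.Structure.funMap (L := arith) (ArithFunc.zero : arith.Functions 0) ![]

/-- The interpretation of `S`. -/
def succIn (x : A) : A := Language.Structure.funMap (L := arith) (ArithFunc.succ : arith.Functions 1) ![x]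

/-- The interpretation of `+`. -/
def addIn (x y : A) : A := Language.Structure.funMap (L := arith) (ArithFunc.add : arith.Functions 2) ![x, y]

theorem realize_tZero {α : Type} (x : α → A) : (tZero : arith.Term α).realize x = zeroIn A :=
  congrArg (Language.Structure.funMap (L := arith) (ArithFunc.zero : arith.Functions 0))
    (funext fun i => i.elim0)

theorem realize_tSucc {α : Type} (x : α → A) (t : arith.Term α) :
    (tSucc t).realize x = succIn (t.realize x) :=
  congrArg (Language.Structure.funMap (L := arith) (ArithFunc.succ : arith.Functions 1))
    (funext fun i => by fin_cases i; rfl)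

theorem realize_tAdd {α : Type} (x : α → A) (s t : arith.Term α) :
    (tAdd s t).realize x = addIn (s.realize x) (t.realize x) :=
  congrArg (Language.Structure.funMap (L := arith) (ArithFunc.add : arith.Functions 2))
    (funext fun i => by fin_cases i <;> rfl)

theorem realize_ltFormula (x y : A) :
    ltFormula.Realize ![x, y] ↔ ∃ z, addIn x (succIn z) = y := by
  simp [ltFormula, Language.Formula.Realize, Language.BoundedFormula.realize_ex, realize_tAdd,
    realize_tSucc, Fin.snoc]

theorem realize_iAlls_relabel {L : FirstOrder.Language.{0, 0}} {B : Type u} [L.Structure B] {n : ℕ}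
    {φ : L.Formula (Fin n)} :
    B ⊨ Language.Formula.iAlls (Fin n) (φ.relabel (Sum.inr : Fin n → Empty ⊕ Fin n)) ↔
      ∀ x : Fin n → B, φ.Realize x := by
  rw [Language.Sentence.Realize, Language.Formula.realize_iAlls]
  refine forall_congr' fun x => ?_
  rw [Language.Formula.realize_relabel]
  rfl

theorem realize_closure {n : ℕ} {φ : arith.Formula (Fin n)} :
    A ⊨ closure φ ↔ ∀ x : Fin n → A, φ.Realize x :=
  realize_iAlls_relabel

variable (hA : A ⊨ peanoArithmetic)
include hA

/-- Induction in a model of Peano arithmetic for a formula with parameters. -/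
theorem realize_induction {n : ℕ} (φ : arith.Formula (Fin n ⊕ Unit)) (x : Fin n → A)
    (h0 : φ.Realize (Sum.elim x fun _ => zeroIn A))
    (hs : ∀ y, φ.Realize (Sum.elim x fun _ => y) → φ.Realize (Sum.elim x fun _ => succIn y))
    (y : A) : φ.Realize (Sum.elim x fun _ => y) := by
  have h := realize_closure.1 (hA.realize_of_mem (inductionAxiom φ) (.inr ⟨n, φ, rfl⟩)) x
  rw [Language.Formula.realize_imp, Language.Formula.realize_inf, Language.Formula.realize_iAlls,
    Language.Formula.realize_iAlls] at h
  refine h ⟨?_, fun y => ?_⟩ fun _ => y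
  · refine Language.BoundedFormula.realize_subst.2 ?_
    refine (iff_of_eq (congrArg₂ (fun w z => Language.BoundedFormula.Realize φ w z) ?_ rfl)).2 h0
    funext a; rcases a with a | a
    · rfl
    · exact realize_tZero _
  · refine Language.BoundedFormula.realize_imp.2 fun hy =>
      Language.BoundedFormula.realize_subst.2 ?_
    refine (iff_of_eq (congrArg₂ (fun w z => Language.BoundedFormula.Realize φ w z) ?_ rfl)).2
      (hs (y ()) hy)
    funext a; rcases a with a | a
    · rfl
    · exact realize_tSucc _ _

theorem succIn_ne_zeroIn (x : A) : succIn x ≠ zeroIn A := by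
  have h := realize_closure.1 (hA.realize_of_mem _ (.inl (.inl rfl))) ![x]
  simpa [Language.Formula.realize_equal, realize_tSucc, realize_tZero, v] using h

theorem succIn_injective {x y : A} (hxy : succIn x = succIn y) : x = y := by
  have h := realize_closure.1 (hA.realize_of_mem _ (.inl (.inr (.inl rfl)))) ![x, y]
  simpa [Language.Formula.realize_equal, realize_tSucc, v, hxy] using h

theorem addIn_zeroIn (x : A) : addIn x (zeroIn A) = x := by
  have h := realize_closure.1 (hA.realize_of_mem _ (.inl (.inr (.inr (.inl rfl))))) ![x]
  simpa [Language.Formula.realize_equal, realize_tAdd, realize_tZero, v] using h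

theorem addIn_succIn (x y : A) : addIn x (succIn y) = succIn (addIn x y) := by
  have h := realize_closure.1 (hA.realize_of_mem _ (.inl (.inr (.inr (.inr (.inl rfl)))))) ![x, y]
  simpa [Language.Formula.realize_equal, realize_tAdd, realize_tSucc, v] using h

theorem addIn_assoc (x y z : A) : addIn (addIn x y) z = addIn x (addIn y z) := by
  let t : Fin 2 ⊕ Unit → arith.Term (Fin 2 ⊕ Unit) := Language.Term.var
  have h := realize_induction hA (Language.Term.equal
    (tAdd (tAdd (t (.inl 0)) (t (.inl 1))) (t (.inr ())))
    (tAdd (t (.inl 0)) (tAdd (t (.inl 1)) (t (.inr ()))))) ![x, y]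
  simp only [Language.Formula.realize_equal, realize_tAdd, t, Language.Term.realize_var,
    Sum.elim_inl, Sum.elim_inr, Matrix.cons_val_zero, Matrix.cons_val_one] at h
  exact h (by simp only [addIn_zeroIn hA])
    (fun y hy => by simp only [addIn_succIn hA, hy]) z

theorem succIn_addIn (x y : A) : addIn (succIn x) y = succIn (addIn x y) := by
  let t : Fin 1 ⊕ Unit → arith.Term (Fin 1 ⊕ Unit) := Language.Term.var
  have h := realize_induction hA (Language.Term.equal
    (tAdd (tSucc (t (.inl 0))) (t (.inr ()))) (tSucc (tAdd (t (.inl 0)) (t (.inr ()))))) ![x]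
  simp only [Language.Formula.realize_equal, realize_tAdd, realize_tSucc, t,
    Language.Term.realize_var, Sum.elim_inl, Sum.elim_inr, Matrix.cons_val_zero] at h
  exact h (by simp only [addIn_zeroIn hA]) (fun y hy => by simp only [addIn_succIn hA, hy]) y

theorem addIn_succIn_ne (x z : A) : addIn x (succIn z) ≠ x := by
  let t : Fin 1 ⊕ Unit → arith.Term (Fin 1 ⊕ Unit) := Language.Term.var
  have h := realize_induction hA (Language.Term.equal
    (tAdd (t (.inr ())) (tSucc (t (.inl 0)))) (t (.inr ()))).not ![z]
  simp only [Language.Formula.realize_not, Language.Formula.realize_equal, realize_tAdd,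
    realize_tSucc, t, Language.Term.realize_var, Sum.elim_inl, Sum.elim_inr,
    Matrix.cons_val_zero] at h
  refine h ?_ (fun y hy hy' => hy ?_) x
  · rw [addIn_succIn hA]; exact succIn_ne_zeroIn hA _
  · rw [succIn_addIn hA] at hy'; exact succIn_injective hA hy'

theorem realize_ltFormula_trans (x y z : A) (hxy : ltFormula.Realize ![x, y])
    (hyz : ltFormula.Realize ![y, z]) : ltFormula.Realize ![x, z] := by
  rw [realize_ltFormula] at *
  obtain ⟨a, rfl⟩ := hxy
  obtain ⟨b, rfl⟩ := hyz
  exact ⟨addIn (succIn a) b, by rw [← addIn_succIn hA, addIn_assoc hA]⟩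

theorem not_realize_ltFormula_self (x : A) : ¬ ltFormula.Realize ![x, x] := by
  rw [realize_ltFormula]
  exact fun ⟨z, hz⟩ => addIn_succIn_ne hA x z hz

theorem realize_ltFormula_numeral (i j : ℕ) (hij : i < j) :
    ltFormula.Realize ![succIn^[i] (zeroIn A), succIn^[j] (zeroIn A)] := by
  have hadd : ∀ k, addIn (succIn^[i] (zeroIn A)) (succIn^[k] (zeroIn A)) =
      succIn^[k + i] (zeroIn A) := fun k => by
    induction k with
    | zero => rw [Function.iterate_zero_apply, addIn_zeroIn hA, Nat.zero_add]
    | succ k ih =>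
      rw [Function.iterate_succ_apply', addIn_succIn hA, ih, Nat.succ_add_eq_add_succ,
        Nat.add_succ, Function.iterate_succ_apply']
  rw [realize_ltFormula]
  obtain ⟨k, rfl⟩ := Nat.exists_eq_add_of_lt hij
  refine ⟨succIn^[k] (zeroIn A), ?_⟩
  rw [← Function.iterate_succ_apply' succIn, hadd]
  congr 1; omega

omit hA in
theorem not_hasElementaryUniversalModel_of_peanoArithmetic_subset {κ : Cardinal.{u}}
    (hreg : κ.IsRegular) (h1 : ℵ₁ < κ) (h2 : κ < 2 ^ ℵ₀) {T : arith.Theory}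
    (hT : peanoArithmetic ⊆ T) : ¬ HasElementaryUniversalModel T κ := by
  have hPA : ∀ N : Language.Theory.ModelType.{0, 0, u} T, N ⊨ peanoArithmetic := fun N =>
    N.is_model.mono hT
  refine not_hasElementaryUniversalModel hreg h1 h2 ltFormula
    (fun N => realize_ltFormula_trans (hPA N)) (fun N => not_realize_ltFormula_self (hPA N))
    fun N M _ => ?_
  simpa using exists_model_chain.{u, u} card_arith_le T ltFormula N _
    (realize_ltFormula_numeral (hPA N)) M

end Arithmetic

/-! ### Rings of p-adic integers -/

section Rings

/-- The formula `φ x₀ x₁ → φ x₁ x₂ → φ x₀ x₂`. -/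
def transFormula {L : FirstOrder.Language.{0, 0}} (φ : L.Formula (Fin 2)) : L.Formula (Fin 3) :=
  (φ.relabel ![0, 1]).imp ((φ.relabel ![1, 2]).imp (φ.relabel ![0, 2]))

theorem realize_transFormula {L : FirstOrder.Language.{0, 0}} {B : Type u} [L.Structure B]
    (φ : L.Formula (Fin 2)) (x : Fin 3 → B) : (transFormula φ).Realize x ↔
      (φ.Realize ![x 0, x 1] → φ.Realize ![x 1, x 2] → φ.Realize ![x 0, x 2]) := by
  have hvec : ∀ i j : Fin 3, x ∘ ![i, j] = ![x i, x j] := fun i j => by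
    funext k; fin_cases k <;> rfl
  simp only [transFormula, Language.Formula.realize_imp, Language.Formula.realize_relabel, hvec]

/-- A formula that defines a transitive relation in `R` does so in all models of the complete
theory of `R`. -/
theorem realize_trans_of_completeTheory {L : FirstOrder.Language.{0, 0}} {R : Type v} [L.Structure R]
    {N : Type u} [L.Structure N] [N ⊨ L.completeTheory R] (φ : L.Formula (Fin 2))
    (h : ∀ x y z : R, φ.Realize ![x, y] → φ.Realize ![y, z] → φ.Realize ![x, z]) (x y z : N)
    (hxy : φ.Realize ![x, y]) (hyz : φ.Realize ![y, z]) : φ.Realize ![x, z] := by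
  have hR : R ⊨ Language.Formula.iAlls (Fin 3) ((transFormula φ).relabel (Sum.inr : Fin 3 → Empty ⊕ Fin 3)) :=
    realize_iAlls_relabel.2 fun x => by
      rw [realize_transFormula]
      exact h _ _ _
  have := realize_iAlls_relabel.1 ((L.completeTheory R).realize_sentence_of_mem (M := N) hR)
    ![x, y, z]
  exact (realize_transFormula _ _).1 this hxy hyz

/-- The formula saying that `x₀` divides `x₁`. -/
def dvdFormula : Language.ring.Formula (Fin 2) :=
  Language.BoundedFormula.ex (n := 0) (Language.Term.bdEqual
    (Language.Term.var (Sum.inl 0) * Language.Term.var (Sum.inr 0))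
    (Language.Term.var (Sum.inl 1)))

/-- The formula saying that `x₀` divides `x₁` but not conversely. -/
def properDvdFormula : Language.ring.Formula (Fin 2) :=
  dvdFormula ⊓ (dvdFormula.relabel ![1, 0]).not

theorem realize_properDvdFormula_iff {A : Type u} [Language.ring.Structure A] (x y : A) :
    properDvdFormula.Realize ![x, y] ↔
      dvdFormula.Realize ![x, y] ∧ ¬ dvdFormula.Realize ![y, x] := by
  have : ![x, y] ∘ ![1, 0] = ![y, x] := by funext k; fin_cases k <;> rfl
  simp only [properDvdFormula, Language.Formula.realize_inf, Language.Formula.realize_not,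
    Language.Formula.realize_relabel, this]

theorem realize_dvdFormula {R : Type u} [CommRing R] [Ring.CompatibleRing R] (x y : R) :
    dvdFormula.Realize ![x, y] ↔ x ∣ y := by
  simp [dvdFormula, Language.Formula.Realize, Language.BoundedFormula.realize_ex, Fin.snoc,
    dvd_iff_exists_eq_mul_right, eq_comm]

/-- In a domain that is not a field the powers of a nonzero nonunit form a chain for proper
divisibility, so its complete theory has no universal model. -/
theorem not_hasElementaryUniversalModel_completeRingTheory {κ : Cardinal.{u}}
    (hreg : κ.IsRegular) (h1 : ℵ₁ < κ) (h2 : κ < 2 ^ ℵ₀) {R : Type} [CommRing R] [IsDomain R]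
    {π : R} (h0 : π ≠ 0) (hu : ¬ IsUnit π) :
    ¬ HasElementaryUniversalModel (completeRingTheory R) κ := by
  let _ := FirstOrder.Ring.compatibleRingOfRing R
  have hR : ∀ x y : R, properDvdFormula.Realize ![x, y] ↔ x ∣ y ∧ ¬ y ∣ x := fun x y => by
    rw [realize_properDvdFormula_iff, realize_dvdFormula, realize_dvdFormula]
  have hmod : R ⊨ completeRingTheory R := ⟨fun _ h => h⟩
  refine not_hasElementaryUniversalModel hreg h1 h2 properDvdFormula (fun N => ?_) (fun N x => ?_)
    fun _ M _ => ?_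
  · have : N ⊨ Language.ring.completeTheory R := N.is_model
    refine realize_trans_of_completeTheory (R := R) properDvdFormula fun x y z hxy hyz => ?_
    rw [hR] at *
    exact ⟨hxy.1.trans hyz.1, fun h => hxy.2 (hyz.1.trans h)⟩
  · rw [realize_properDvdFormula_iff]
    exact fun h => h.2 h.1
  · have hcard : Language.ring.card ≤ ℵ₀ := by
      rw [FirstOrder.Ring.card_ring]; exact (natCast_lt_aleph0 (n := 5)).le
    simpa using exists_model_chain.{u, 0} hcard (completeRingTheory R) properDvdFormula
      (.of _ R) (fun n => π ^ n) (fun i j hij => (hR _ _).2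
        ⟨pow_dvd_pow π hij.le, fun h => (pow_dvd_pow_iff h0 hu).1 h |>.not_gt hij⟩) M

/-- An inverse of `p` would lie in `ℚ_[p]` and be integral over the integrally closed ring
`ℤ_[p]`. -/
theorem not_isUnit_natCast_integralClosure (p : ℕ) [Fact p.Prime] (K : Type) [Field K]
    [Algebra ℚ_[p] K] [Algebra ℤ_[p] K] [IsScalarTower ℤ_[p] ℚ_[p] K] :
    ¬ IsUnit (p : integralClosure ℤ_[p] K) := by
  intro hu
  obtain ⟨x, hx⟩ := hu.exists_right_inv
  have hp : (p : ℚ_[p]) ≠ 0 := Nat.cast_ne_zero.2 (Fact.out : p.Prime).ne_zero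
  have hK : (p : K) * (x : K) = 1 := by exact_mod_cast congrArg Subtype.val hx
  have hxK : (x : K) = algebraMap ℚ_[p] K (p : ℚ_[p])⁻¹ := by
    rw [map_inv₀, map_natCast]
    exact eq_inv_of_mul_eq_one_right hK
  have hint : IsIntegral ℤ_[p] (p : ℚ_[p])⁻¹ := by
    have := x.2
    rw [hxK] at this
    exact (isIntegral_algebraMap_iff (algebraMap ℚ_[p] K).injective).1 this
  obtain ⟨y, hy⟩ := IsIntegrallyClosed.isIntegral_iff.1 hint
  refine PadicInt.prime_p.not_isUnit (IsUnit.of_mul_eq_one y ?_ : IsUnit (p : ℤ_[p]))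
  apply FaithfulSMul.algebraMap_injective ℤ_[p] ℚ_[p]
  rw [map_mul, hy, map_natCast, mul_inv_cancel₀ hp, map_one]

end Rings

end UniversalModels

theorem mainTheorem11 (κ : Cardinal.{u}) (hreg : κ.IsRegular)
    (h1 : Cardinal.aleph 1 < κ) (h2 : κ < 2 ^ Cardinal.aleph0) :
    ¬ UniversalModels.HasUniversalPartialOrder κ ∧
    ¬ UniversalModels.HasUniversalBooleanAlgebra κ ∧
    ¬ UniversalModels.HasUniversalLattice κ ∧
    ¬ UniversalModels.HasUniversalOrderedField κ ∧
    (¬ UniversalModels.HasUniversalOrderedGroup κ ∧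
      ¬ UniversalModels.HasUniversalOrderedCommGroup κ) ∧
    (¬ UniversalModels.HasElementaryUniversalModel UniversalModels.completeNumberTheory κ ∧
      ∀ T : UniversalModels.arith.Theory, UniversalModels.peanoArithmetic ⊆ T →
        ¬ UniversalModels.HasElementaryUniversalModel T κ) ∧
    ∀ (p : ℕ) [Fact p.Prime],
      ¬ UniversalModels.HasElementaryUniversalModel
          (UniversalModels.completeRingTheory ℤ_[p]) κ ∧
      ∀ (K : Type) [Field K] [Algebra ℚ_[p] K] [FiniteDimensional ℚ_[p] K]
        [Algebra ℤ_[p] K] [IsScalarTower ℤ_[p] ℚ_[p] K],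
        ¬ UniversalModels.HasElementaryUniversalModel
            (UniversalModels.completeRingTheory (integralClosure ℤ_[p] K)) κ := by
  open UniversalModels in
  refine ⟨not_hasUniversalPartialOrder hreg h1 h2, not_hasUniversalBooleanAlgebra hreg h1 h2,
    not_hasUniversalLattice hreg h1 h2, not_hasUniversalOrderedField hreg h1 h2,
    ⟨not_hasUniversalOrderedGroup hreg h1 h2, not_hasUniversalOrderedCommGroup hreg h1 h2⟩,
    ⟨not_hasElementaryUniversalModel_of_peanoArithmetic_subset hreg h1 h2
      peanoArithmetic_subset_completeNumberTheory,
    fun T => not_hasElementaryUniversalModel_of_peanoArithmetic_subset hreg h1 h2⟩,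
    fun p _ => ⟨?_, fun K _ _ _ _ _ => ?_⟩⟩
  · exact not_hasElementaryUniversalModel_completeRingTheory hreg h1 h2
      PadicInt.prime_p.ne_zero PadicInt.prime_p.not_isUnit
  · refine not_hasElementaryUniversalModel_completeRingTheory hreg h1 h2 ?_
      (not_isUnit_natCast_integralClosure p K)
    have : CharZero K := charZero_of_injective_algebraMap (algebraMap ℚ_[p] K).injective
    exact Nat.cast_ne_zero.2 (Fact.out : p.Prime).ne_zero
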